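/- Let $k\ge 1$ and $n\ge 0$ be integers, let $A\in\mathbb R^{n\times n}$ be symmetric positive semidefinite, and let $X\in\mathbb R^{n\times k}$ have rows of Euclidean norm $1$. Let $g$ be uniformly distributed on the unit sphere $\{u\in\mathbb R^k:\|u\|_2=1\}$, and let $x=\operatorname{sgn}(Xg)\in\{-1,1\}^n$, with the sign taken entrywise and $\operatorname{sgn}(0)=1$. Put $$\gamma(k)=\frac2k\left(\frac{\Gamma((k+1)/2)}{\Gamma(k/2)}\right)^2 .$$ Then $x^{\mathsf T}Ax$ is integrable and $$\mathbb E_g[x^{\mathsf T}Ax]\ \ge\ \frac{2}{\pi\gamma(k)}\operatorname{tr}(AXX^{\mathsf T}),$$ so that, whenever $\operatorname{tr}(AXX^{\mathsf T})\neq 0$, $$\frac{\mathbb E_g[x^{\mathsf T}Ax]}{\operatorname{tr}(AXX^{\mathsf T})}\ \ge\ \frac{2}{\pi\gamma(k)} .$$ Moreover $\gamma(k)=1-\Theta(1/k)$, that is, there are constants $c,C>0$ with $c/k\le 1-\gamma(k)\le C/k$ for all $k\ge1$; and $$\frac{2}{\pi\gamma(k)}=\frac2\pi\left(1+\frac1{2k}+o\!\left(\frac1k\right)\right)\qquad(k\to\infty),$$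 where the $o(1/k)$ term depends on $k$ only. -/

import Mathlib

open MeasureTheory Matrix Filter Asymptotics
open scoped Topology

noncomputable section

namespace Grothendieck

/-- The quadratic objective `xᵀ A x`. -/
def iqp {n : ℕ} (A : Matrix (Fin n) (Fin n) ℝ) (x : Fin n → ℝ) : ℝ :=
  x ⬝ᵥ (A *ᵥ x)

/-- The semidefinite objective `tr (A S)`. -/
def sdp {n : ℕ} (A S : Matrix (Fin n) (Fin n) ℝ) : ℝ :=
  (A * S).trace

/-- The sign function with values in `{-1, 1}`; here the value at `0` is set to `1`. -/
def sgn (t : ℝ) : ℝ := if 0 ≤ t then 1 else -1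

/-- The unit sphere of the Euclidean space `ℝ^k`. -/
abbrev unitSphere (k : ℕ) : Set (EuclideanSpace ℝ (Fin k)) :=
  Metric.sphere (0 : EuclideanSpace ℝ (Fin k)) 1

/-- The uniform distribution on the unit sphere of `ℝ^k`: the surface measure, normalised to
total mass one. -/
def uniformSphere (k : ℕ) : Measure (unitSphere k) :=
  ((volume : Measure (EuclideanSpace ℝ (Fin k))).toSphere Set.univ)⁻¹ •
    (volume : Measure (EuclideanSpace ℝ (Fin k))).toSphere

theorem isProbabilityMeasure_uniformSphere {k : ℕ} (hk : 1 ≤ k) :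
    IsProbabilityMeasure (uniformSphere k) := by
  have : Nonempty (Fin k) := ⟨⟨0, hk⟩⟩
  refine ⟨?_⟩
  rw [uniformSphere, Measure.smul_apply, smul_eq_mul]
  refine ENNReal.inv_mul_cancel ?_ (measure_ne_top _ _)
  rw [Measure.toSphere_apply_univ]
  refine mul_ne_zero ?_ (Metric.measure_ball_pos _ _ one_pos).ne'
  simpa using (Nat.one_le_iff_ne_zero.mp hk)

/-- The point `sgn (X g)`, with the sign taken entrywise. -/
def roundedPoint {n k : ℕ} (X : Matrix (Fin n) (Fin k) ℝ) (g : unitSphere k) : Fin n → ℝ :=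
  fun i => sgn ((X *ᵥ (g : EuclideanSpace ℝ (Fin k)).ofLp) i)

/-- The expectation of `xᵀ A x` for `x = sgn (X g)` with `g` uniform on the unit sphere. -/
def expectedRounded {n k : ℕ} (A : Matrix (Fin n) (Fin n) ℝ) (X : Matrix (Fin n) (Fin k) ℝ) : ℝ :=
  ∫ g, iqp A (roundedPoint X g) ∂(uniformSphere k)

/-- The expected approximation ratio (meaningful when `tr (A X Xᵀ) ≠ 0`). -/
def ratio {n k : ℕ} (A : Matrix (Fin n) (Fin n) ℝ) (X : Matrix (Fin n) (Fin k) ℝ) : ℝ :=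
  expectedRounded A X / sdp A (X * Xᵀ)

/-- `γ(k) = (2 / k) (Γ((k + 1) / 2) / Γ(k / 2))²`. -/
def gam (k : ℕ) : ℝ :=
  2 / (k : ℝ) * (Real.Gamma (((k : ℝ) + 1) / 2) / Real.Gamma ((k : ℝ) / 2)) ^ 2

end Grothendieck

end

/-! ### Sphere averages from Gaussian integrals -/

namespace Grothendieck

/-! Let `p = Xg`, `s = sgn (Xg)`, and `m = 𝔼|⟪u, g⟫|` for a unit vector `u`. Since the rows `x i`
are unit vectors, `𝔼[s i * p j] = m⟪x i, x j⟫` and `𝔼[p i * p j] = ⟪x i, x j⟫ / k`. Hence the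
residual `s - k m p` has second-moment matrix `𝔼[s sᵀ] - k m² X Xᵀ`; pairing it with the positive
semidefinite `A` gives a nonnegative number, and `k m² = 2/(π γ(k))` (`le_expectedRounded`). The
moments reduce to one-dimensional Gaussian integrals through polar coordinates and rotation
invariance. The asymptotics of `γ` rest on the recurrence `γ(k) γ(k+1) = k/(k+1)`, log-convexity of
Gamma, and monotonicity of `γ(k)(1 + 1/(2k))` along steps of two (`gam_le`). -/

/-- Integral of a positively homogeneous function against a Gaussian weight, in polar
coordinates. -/
theorem integral_mul_exp_neg_norm_sq {k : ℕ} (hk : 1 ≤ k) (d : ℕ)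
    (f : EuclideanSpace ℝ (Fin k) → ℝ) (hf : ∀ r : ℝ, 0 < r → ∀ x, f (r • x) = r ^ d * f x) :
    ∫ x, f x * Real.exp (-‖x‖ ^ 2) =
      (∫ g : unitSphere k, f g ∂(volume : Measure (EuclideanSpace ℝ (Fin k))).toSphere) *
        (Real.Gamma (((k : ℝ) + d) / 2) / 2) := by
  have : Nonempty (Fin k) := ⟨⟨0, hk⟩⟩
  have hdim : Module.finrank ℝ (EuclideanSpace ℝ (Fin k)) = k := by simp
  calc ∫ x, f x * Real.exp (-‖x‖ ^ 2)
      = ∫ x : ({(0)}ᶜ : Set (EuclideanSpace ℝ (Fin k))), f x.1 * Real.exp (-‖x.1‖ ^ 2)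
          ∂(Measure.comap Subtype.val volume) := by
        rw [integral_subtype_comap (measurableSet_singleton _).compl
          fun x ↦ f x * Real.exp (-‖x‖ ^ 2), restrict_compl_singleton]
    _ = ∫ p, f p.1 * (p.2.1 ^ d * Real.exp (-p.2.1 ^ 2))
          ∂((volume : Measure (EuclideanSpace ℝ (Fin k))).toSphere.prod
            (.volumeIoiPow (k - 1))) := by
        have h := (volume : Measure (EuclideanSpace ℝ (Fin k)))
          |>.measurePreserving_homeomorphUnitSphereProd.integral_comp
          (Homeomorph.measurableEmbedding _)
          (fun p ↦ f p.1 * (p.2.1 ^ d * Real.exp (-p.2.1 ^ 2)))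
        rw [hdim] at h
        rw [← h]
        refine integral_congr_ae (.of_forall fun x ↦ ?_)
        have hx : (0 : ℝ) < ‖x.1‖ := norm_pos_iff.2 x.2
        have h1 := hf ‖x.1‖⁻¹ (inv_pos.2 hx) x.1
        simp only [homeomorphUnitSphereProd_apply_fst_coe,
          homeomorphUnitSphereProd_apply_snd_coe, h1, inv_pow]
        field_simp
    _ = (∫ g : unitSphere k, f g ∂(volume : Measure (EuclideanSpace ℝ (Fin k))).toSphere) *
          ∫ r : Set.Ioi (0 : ℝ), r.1 ^ d * Real.exp (-r.1 ^ 2) ∂(.volumeIoiPow (k - 1)) :=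
        integral_prod_mul (fun g : unitSphere k ↦ f g)
          (fun r : Set.Ioi (0 : ℝ) ↦ r.1 ^ d * Real.exp (-r.1 ^ 2))
    _ = _ := by
        congr 1
        simp only [Measure.volumeIoiPow, ENNReal.ofReal]
        rw [integral_withDensity_eq_integral_smul
            ((measurable_subtype_coe.pow_const _).real_toNNReal),
          integral_subtype_comap measurableSet_Ioi
            fun a ↦ Real.toNNReal (a ^ (k - 1)) • (a ^ d * Real.exp (-a ^ 2))]
        -- The exponent collects `r ^ (k - 1)` from the radial measure and `r ^ d` from homogeneity.
        have h := integral_rpow_mul_exp_neg_rpow (p := 2) (q := (k : ℝ) + d - 1) (by norm_num)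
          (by have : (1 : ℝ) ≤ k := by exact_mod_cast hk
              have : (0 : ℝ) ≤ d := d.cast_nonneg
              linarith)
        rw [show ((k : ℝ) + d) / 2 = ((k : ℝ) + d - 1 + 1) / 2 by ring,
          div_eq_inv_mul, ← one_div, ← h]
        refine setIntegral_congr_fun measurableSet_Ioi fun r hr ↦ ?_
        have hr' : 0 < r := hr
        have he : (k : ℝ) + d - 1 = ((k - 1 + d : ℕ) : ℝ) := by
          push_cast [hk]; ring
        simp only [NNReal.smul_def, smul_eq_mul]
        rw [Real.coe_toNNReal _ (by positivity), he, Real.rpow_natCast, pow_add]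
        norm_num [mul_assoc]

/-- Gaussian integral of a ridge function. -/
theorem integral_ridge_mul_exp_neg_norm_sq {k : ℕ} (hk : 1 ≤ k) (φ : ℝ → ℝ)
    (u : EuclideanSpace ℝ (Fin k)) (hu : ‖u‖ = 1) :
    ∫ x, φ (inner ℝ u x) * Real.exp (-‖x‖ ^ 2) =
      (∫ t, φ t * Real.exp (-t ^ 2)) * √Real.pi ^ (k - 1) := by
  let i₀ : Fin k := ⟨0, hk⟩
  -- Rotate `u` to a coordinate vector; Fubini then leaves `k - 1` plain Gaussian factors.
  obtain ⟨b, hb⟩ := Orthonormal.exists_orthonormalBasis_extension_of_card_eq (𝕜 := ℝ)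
    (E := EuclideanSpace ℝ (Fin k)) (ι := Fin k) (by simp) (v := fun _ ↦ u) (s := {i₀})
    (by
      rw [orthonormal_iff_ite]
      rintro ⟨i, rfl⟩ ⟨j, rfl⟩
      simp [hu])
  have hb0 : b i₀ = u := hb i₀ rfl
  have h1 := b.measurePreserving_repr.integral_comp b.repr.toHomeomorph.measurableEmbedding
    (fun y : EuclideanSpace ℝ (Fin k) ↦ φ (y i₀) * Real.exp (-‖y‖ ^ 2))
  simp only [b.repr_apply_apply, hb0, LinearIsometryEquiv.norm_map] at h1
  rw [h1]
  have h2 : ∀ y : EuclideanSpace ℝ (Fin k), φ (y i₀) * Real.exp (-‖y‖ ^ 2) =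
      (fun z : Fin k → ℝ ↦ ∏ i, (if i = i₀ then φ (z i) else 1) * Real.exp (-z i ^ 2))
        (WithLp.ofLp y) := by
    intro y
    rw [EuclideanSpace.norm_sq_eq]
    simp only [Real.norm_eq_abs, sq_abs]
    rw [Finset.prod_mul_distrib, ← Real.exp_sum, Finset.sum_neg_distrib]
    simp
  have h3 := (EuclideanSpace.volume_preserving_symm_measurableEquiv_toLp (Fin k)).integral_comp
    (MeasurableEquiv.measurableEmbedding _)
    (fun z : Fin k → ℝ ↦ ∏ i, (if i = i₀ then φ (z i) else 1) * Real.exp (-z i ^ 2))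
  rw [integral_congr_ae (.of_forall h2)]
  refine h3.trans ?_
  rw [volume_pi,
    integral_fintype_prod_eq_prod (fun i (t : ℝ) ↦ (if i = i₀ then φ t else 1) * Real.exp (-t ^ 2)),
    ← Finset.mul_prod_erase _ _ (Finset.mem_univ i₀)]
  refine congrArg₂ (· * ·) (by simp) ?_
  rw [Finset.prod_congr rfl (g := fun _ ↦ √Real.pi)]
  · simp
  · intro i hi
    simpa [Finset.ne_of_mem_erase hi] using integral_gaussian 1

/-- Reflection in the line of `u` fixes `⟪u, x⟫` and negates `⟪w, x⟫`, so the integral equals its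
own negative; no integrability is required. -/
theorem integral_ridge_mul_inner_eq_zero {k : ℕ} (φ : ℝ → ℝ)
    (u w : EuclideanSpace ℝ (Fin k)) (huw : inner ℝ u w = 0) :
    ∫ x, φ (inner ℝ u x) * inner ℝ w x * Real.exp (-‖x‖ ^ 2) = 0 := by
  let R := (ℝ ∙ u).reflection
  have hRu : R u = u :=
    Submodule.reflection_mem_subspace_eq_self (Submodule.mem_span_singleton_self u)
  have hRw : R w = -w := Submodule.reflection_mem_subspace_orthogonalComplement_eq_neg
    (Submodule.mem_orthogonal_singleton_iff_inner_right.2 huw)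
  have h := R.measurePreserving.integral_comp R.toHomeomorph.measurableEmbedding
    (fun x ↦ φ (inner ℝ u x) * inner ℝ w x * Real.exp (-‖x‖ ^ 2))
  have h1 : ∀ x, inner ℝ u (R x) = inner ℝ u x := fun x ↦ by
    conv_lhs => rw [← hRu]
    exact R.inner_map_map u x
  have h2 : ∀ x, inner ℝ w (R x) = -inner ℝ w x := fun x ↦ by
    have : w = R (-w) := by rw [map_neg, hRw, neg_neg]
    conv_lhs => rw [this]
    rw [R.inner_map_map, inner_neg_left]
  simp only [h1, h2, R.norm_map, mul_neg, neg_mul, integral_neg] at h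
  linarith

theorem integral_uniformSphere {k : ℕ} (hk : 1 ≤ k) (d : ℕ)
    (f : EuclideanSpace ℝ (Fin k) → ℝ) (hf : ∀ r : ℝ, 0 < r → ∀ x, f (r • x) = r ^ d * f x) :
    ∫ g, f g ∂(uniformSphere k) =
      (∫ x, f x * Real.exp (-‖x‖ ^ 2)) / √Real.pi ^ k *
        (Real.Gamma ((k : ℝ) / 2) / Real.Gamma (((k : ℝ) + d) / 2)) := by
  have hk0 : (0 : ℝ) < k := by exact_mod_cast hk
  -- The case `f = 1`, `d = 0` determines the total surface mass used for normalisation.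
  have h1 := integral_mul_exp_neg_norm_sq hk 0 (fun _ ↦ 1) (by simp)
  have h2 := integral_ridge_mul_exp_neg_norm_sq hk (fun _ ↦ 1)
    (EuclideanSpace.single ⟨0, hk⟩ 1) (by simp)
  have h3 : ∫ t : ℝ, (1 : ℝ) * Real.exp (-t ^ 2) = √Real.pi := by
    simpa using integral_gaussian 1
  rw [h2, h3, ← pow_succ', Nat.sub_add_cancel hk] at h1
  simp only [integral_const, smul_eq_mul, mul_one, Nat.cast_zero, add_zero] at h1
  rw [integral_mul_exp_neg_norm_sq hk d f hf, uniformSphere, integral_smul_measure,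
    ENNReal.toReal_inv, h1, smul_eq_mul, measureReal_def]
  have hG : Real.Gamma ((k : ℝ) / 2) ≠ 0 := (Real.Gamma_pos_of_pos (by positivity)).ne'
  have hG' : Real.Gamma (((k : ℝ) + d) / 2) ≠ 0 := (Real.Gamma_pos_of_pos (by positivity)).ne'
  have hpi : √Real.pi ^ k ≠ 0 := by positivity
  rw [h1] at hpi
  have hs := left_ne_zero_of_mul hpi
  rw [measureReal_def] at hs
  field_simp

end Grothendieck
-- Bounds and asymptotics for `gam`
namespace Grothendieck

theorem gam_pos {k : ℕ} (hk : 1 ≤ k) : 0 < gam k := by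
  have hk0 : (0 : ℝ) < k := by exact_mod_cast hk
  have h1 : 0 < Real.Gamma ((k : ℝ) / 2) := Real.Gamma_pos_of_pos (by positivity)
  have h2 : 0 < Real.Gamma (((k : ℝ) + 1) / 2) := Real.Gamma_pos_of_pos (by positivity)
  unfold gam
  positivity

theorem gam_mul_gam_succ {k : ℕ} (hk : 1 ≤ k) :
    gam k * gam (k + 1) = k / (k + 1) := by
  have hk0 : (0 : ℝ) < k := by exact_mod_cast hk
  have h1 : Real.Gamma ((k : ℝ) / 2) ≠ 0 := (Real.Gamma_pos_of_pos (by positivity)).ne'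
  have h2 : Real.Gamma (((k : ℝ) + 1) / 2) ≠ 0 := (Real.Gamma_pos_of_pos (by positivity)).ne'
  have h3 : Real.Gamma (((k : ℝ) + 1 + 1) / 2) = k / 2 * Real.Gamma ((k : ℝ) / 2) := by
    rw [← Real.Gamma_add_one (by positivity)]
    congr 1
    ring
  unfold gam
  push_cast
  rw [h3]
  field_simp

/-- Log-convexity of Gamma at the midpoint of `k/2` and `k/2 + 1`. -/
theorem gam_le_one {k : ℕ} (hk : 1 ≤ k) : gam k ≤ 1 := by
  have hk0 : (0 : ℝ) < k := by exact_mod_cast hk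
  have h1 : 0 < Real.Gamma ((k : ℝ) / 2) := Real.Gamma_pos_of_pos (by positivity)
  have h2 : 0 < Real.Gamma (((k : ℝ) + 1) / 2) := Real.Gamma_pos_of_pos (by positivity)
  have h3 : Real.Gamma ((k : ℝ) / 2 + 1) = k / 2 * Real.Gamma ((k : ℝ) / 2) :=
    Real.Gamma_add_one (by positivity)
  have h := Real.Gamma_mul_add_mul_le_rpow_Gamma_mul_rpow_Gamma (s := (k : ℝ) / 2)
    (t := (k : ℝ) / 2 + 1) (a := 1 / 2) (b := 1 / 2) (by positivity) (by positivity)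
    (by norm_num) (by norm_num) (by norm_num)
  rw [show (1 / 2 : ℝ) * (k / 2) + 1 / 2 * (k / 2 + 1) = (k + 1) / 2 by ring, h3,
    ← Real.mul_rpow h1.le (by positivity), ← Real.sqrt_eq_rpow] at h
  have h' := (Real.le_sqrt h2.le (by positivity)).1 h
  unfold gam
  rw [div_pow, div_mul_div_comm, div_le_one (by positivity)]
  nlinarith

/-- For `k ≥ 2`, `gam (k - 1) ≤ 1` in the recurrence gives `gam k ≥ (k - 1)/k`. -/
theorem one_sub_inv_le_gam {k : ℕ} (hk : 1 ≤ k) : 1 - 1 / (k : ℝ) ≤ gam k := by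
  obtain rfl | hk2 : k = 1 ∨ 2 ≤ k := by omega
  · simpa using (gam_pos le_rfl).le
  obtain ⟨j, rfl⟩ : ∃ j, k = j + 1 := ⟨k - 1, by omega⟩
  have hj : 1 ≤ j := by omega
  have h := gam_mul_gam_succ hj
  have h1 := gam_le_one hj
  have h2 := gam_pos hk
  have h3 : (j : ℝ) / (j + 1) = 1 - 1 / ((j + 1 : ℕ) : ℝ) := by
    push_cast; field_simp; ring
  rw [← h3, ← h]
  nlinarith

theorem gam_add_two {k : ℕ} (hk : 1 ≤ k) :
    gam (k + 2) = gam k * ((k + 1) ^ 2 / (k * (k + 2))) := by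
  have hk0 : (0 : ℝ) < k := by exact_mod_cast hk
  have h1 := gam_mul_gam_succ hk
  have h2 := gam_mul_gam_succ (k := k + 1) (by omega)
  have h3 := gam_pos (k := k + 1) (by omega)
  have e1 : gam k = k / (k + 1) / gam (k + 1) := by rw [← h1]; field_simp
  have e2 : gam (k + 2) = (k + 1) / (k + 2) / gam (k + 1) := by
    rw [eq_div_iff h3.ne', mul_comm, h2]
    push_cast
    ring
  rw [e1, e2]
  field_simp

theorem tendsto_gam : Tendsto gam atTop (𝓝 1) := by
  have h : Tendsto (fun k : ℕ ↦ 1 - 1 / (k : ℝ)) atTop (𝓝 1) := by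
    simpa using tendsto_const_nhds.sub (tendsto_one_div_atTop_nhds_zero_nat (𝕜 := ℝ))
  refine tendsto_of_tendsto_of_tendsto_of_le_of_le' h tendsto_const_nhds ?_ ?_
  · filter_upwards [eventually_ge_atTop 1] with k hk using one_sub_inv_le_gam hk
  · filter_upwards [eventually_ge_atTop 1] with k hk using gam_le_one hk

/-- The sequence `r` increases along steps of two and tends to `1`, so it never exceeds `1`. -/
theorem gam_le {k : ℕ} (hk : 1 ≤ k) : gam k ≤ k / (k + 1 / 2) := by
  let r : ℕ → ℝ := fun j ↦ gam j * (1 + 1 / 2 * (1 / (j : ℝ)))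
  have hstep : ∀ j, 1 ≤ j → r j ≤ r (j + 2) := by
    intro j hj
    have hj0 : (0 : ℝ) < j := by exact_mod_cast hj
    simp only [r]
    rw [gam_add_two hj, mul_assoc]
    refine mul_le_mul_of_nonneg_left ?_ (gam_pos hj).le
    push_cast
    rw [show (1 : ℝ) + 1 / 2 * (1 / j) = (2 * j + 1) / (2 * j) by field_simp,
      show (j + 1 : ℝ) ^ 2 / (j * (j + 2)) * (1 + 1 / 2 * (1 / (j + 2)))
        = (j + 1) ^ 2 * (2 * j + 5) / (2 * j * (j + 2) ^ 2) by field_simp; ring,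
      div_le_div_iff₀ (by positivity) (by positivity)]
    -- After cancelling `2 * j`, the two cubics differ only in their constant terms, `4` and `5`.
    nlinarith
  have hmono : Monotone fun m ↦ r (k + 2 * m) :=
    monotone_nat_of_le_succ fun m ↦ hstep (k + 2 * m) (by omega)
  have hlim : Tendsto r atTop (𝓝 1) := by
    have h := tendsto_gam.mul ((tendsto_const_nhds (x := (1 : ℝ))).add
      ((tendsto_one_div_atTop_nhds_zero_nat (𝕜 := ℝ)).const_mul (1 / 2)))
    rwa [mul_zero, add_zero, mul_one] at h
  have hlim' : Tendsto (fun m ↦ r (k + 2 * m)) atTop (𝓝 1) :=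
    hlim.comp (tendsto_atTop_mono (fun m ↦ (by omega : m ≤ k + 2 * m)) tendsto_id)
  have h := hmono.ge_of_tendsto hlim' 0
  have hk0 : (0 : ℝ) < k := by exact_mod_cast hk
  simp only [r, mul_zero, add_zero] at h
  rw [le_div_iff₀ (by positivity)]
  have : gam k * (k + 1 / 2) = gam k * (1 + 1 / 2 * (1 / (k : ℝ))) * k := by field_simp
  rw [this]
  nlinarith

theorem inv_gam_bounds {k : ℕ} (hk : 1 ≤ k) :
    1 + 1 / (2 * (k : ℝ)) ≤ (gam k)⁻¹ ∧
      (gam k)⁻¹ ≤ 1 + 1 / (2 * (k : ℝ)) + 1 / (4 * (k : ℝ) ^ 2) := by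
  have hk0 : (0 : ℝ) < k := by exact_mod_cast hk
  have hg := gam_pos hk
  have hg' := gam_pos (k := k + 1) (by omega)
  constructor
  · rw [le_inv_comm₀ (by positivity) hg]
    refine (gam_le hk).trans_eq ?_
    field_simp
  · have h1 := gam_mul_gam_succ hk
    have h2 := gam_le (k := k + 1) (by omega)
    -- The recurrence turns the upper bound on `gam (k + 1)` into one on `(gam k)⁻¹`.
    have e1 : (gam k)⁻¹ = (k + 1) / k * gam (k + 1) := by
      have : (k : ℝ) = gam k * gam (k + 1) * (k + 1) := by rw [h1]; field_simp
      rw [div_mul_eq_mul_div, eq_div_iff hk0.ne', inv_mul_eq_iff_eq_mul₀ hg.ne']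
      linarith
    rw [e1]
    refine (mul_le_mul_of_nonneg_left h2 (by positivity)).trans ?_
    push_cast
    rw [show (1 : ℝ) + 1 / (2 * k) + 1 / (4 * k ^ 2) = (4 * k ^ 2 + 2 * k + 1) / (4 * k ^ 2) by
        field_simp; ring,
      show (k + 1 : ℝ) / k * ((k + 1) / (k + 1 + 1 / 2)) = 2 * (k + 1) ^ 2 / (k * (2 * k + 3)) by
        field_simp; ring,
      div_le_div_iff₀ (by positivity) (by positivity)]
    nlinarith [pow_pos hk0 2, pow_pos hk0 3]

theorem one_sub_gam_bounds {k : ℕ} (hk : 1 ≤ k) :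
    (1 / 3) / (k : ℝ) ≤ 1 - gam k ∧ 1 - gam k ≤ 1 / (k : ℝ) := by
  have hk1 : (1 : ℝ) ≤ k := by exact_mod_cast hk
  refine ⟨?_, by linarith [one_sub_inv_le_gam hk]⟩
  -- The right side is `1/(2k + 1)`, and `2k + 1 ≤ 3k`; equality at `k = 1` fixes the `1/3`.
  have h : (1 / 3) / (k : ℝ) ≤ 1 - k / (k + 1 / 2) := by
    rw [show (1 : ℝ) - k / (k + 1 / 2) = 1 / (2 * k + 1) by field_simp; ring,
      div_le_div_iff₀ (by positivity) (by positivity)]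
    linarith
  linarith [gam_le hk]

theorem two_div_pi_mul_gam_asymptotic :
    ∃ ε : ℕ → ℝ, ε =o[atTop] (fun k : ℕ => 1 / (k : ℝ)) ∧ ∀ k : ℕ, 1 ≤ k →
      2 / (Real.pi * gam k) = 2 / Real.pi * (1 + 1 / (2 * (k : ℝ)) + ε k) := by
  refine ⟨fun k ↦ (gam k)⁻¹ - 1 - 1 / (2 * (k : ℝ)), ?_, fun k _ ↦ ?_⟩
  · have h1 : (fun k : ℕ ↦ (gam k)⁻¹ - 1 - 1 / (2 * (k : ℝ))) =O[atTop]
        fun k : ℕ ↦ (1 / (k : ℝ)) * (1 / (k : ℝ)) := by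
      refine IsBigO.of_bound 1 ?_
      filter_upwards [eventually_ge_atTop 1] with k hk
      have hk0 : (0 : ℝ) < k := by exact_mod_cast hk
      obtain ⟨h, h'⟩ := inv_gam_bounds hk
      have h4 : 1 / (4 * (k : ℝ) ^ 2) ≤ 1 / k * (1 / k) := by
        rw [div_mul_div_comm, div_le_div_iff₀ (by positivity) (by positivity)]
        nlinarith [pow_pos hk0 2]
      rw [Real.norm_of_nonneg (by linarith), Real.norm_of_nonneg (by positivity)]
      linarith
    refine h1.trans_isLittleO ?_
    have h2 : (fun k : ℕ ↦ 1 / (k : ℝ)) =o[atTop] fun _ ↦ (1 : ℝ) :=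
      (isLittleO_one_iff ℝ).2 tendsto_one_div_atTop_nhds_zero_nat
    simpa using (isBigO_refl (fun k : ℕ ↦ 1 / (k : ℝ)) atTop).mul_isLittleO h2
  · rw [← div_div, div_eq_mul_inv (2 / Real.pi)]
    ring

end Grothendieck
-- Moments on the sphere and the rounding bound
namespace Grothendieck

theorem measurable_sgn : Measurable sgn :=
  Measurable.ite measurableSet_Ici measurable_const measurable_const

theorem abs_sgn (t : ℝ) : |sgn t| = 1 := by
  unfold sgn
  split_ifs <;> simp

theorem sgn_mul_self (t : ℝ) : sgn t * t = |t| := by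
  unfold sgn
  split_ifs with h
  · rw [abs_of_nonneg h, one_mul]
  · rw [abs_of_neg (not_le.1 h), neg_one_mul]

theorem sgn_pos_mul {r : ℝ} (hr : 0 < r) (t : ℝ) : sgn (r * t) = sgn t := by
  simp [sgn, mul_nonneg_iff_of_pos_left hr]

theorem integral_abs_mul_exp_neg_sq : ∫ t : ℝ, |t| * Real.exp (-t ^ 2) = 1 := by
  have h := integral_comp_abs (f := fun t ↦ t * Real.exp (-t ^ 2))
  simp only [sq_abs] at h
  have h2 := integral_rpow_mul_exp_neg_rpow (p := 2) (q := 1) (by norm_num) (by norm_num)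
  norm_num at h2
  rw [h, h2]
  norm_num

theorem integral_sq_mul_exp_neg_sq : ∫ t : ℝ, t ^ 2 * Real.exp (-t ^ 2) = √Real.pi / 2 := by
  have h := integral_comp_abs (f := fun t ↦ t ^ 2 * Real.exp (-t ^ 2))
  simp only [sq_abs] at h
  have h2 := integral_rpow_mul_exp_neg_rpow (p := 2) (q := 2) (by norm_num) (by norm_num)
  have h3 : Real.Gamma (3 / 2) = √Real.pi / 2 := by
    rw [show (3 / 2 : ℝ) = 1 / 2 + 1 by norm_num, Real.Gamma_add_one (by norm_num),
      Real.Gamma_one_half_eq]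
    ring
  norm_num [h3] at h2
  rw [h, h2]
  ring

variable {k : ℕ}

/-- The mean `𝔼 |⟪u, g⟫|` for a unit vector `u` and `g` uniform on the unit sphere. -/
noncomputable def meanAbs (k : ℕ) : ℝ :=
  Real.Gamma ((k : ℝ) / 2) / (√Real.pi * Real.Gamma (((k : ℝ) + 1) / 2))

theorem mul_meanAbs_sq (hk : 1 ≤ k) : k * meanAbs k ^ 2 = 2 / (Real.pi * gam k) := by
  have hk0 : (0 : ℝ) < k := by exact_mod_cast hk
  have h1 : Real.Gamma ((k : ℝ) / 2) ≠ 0 := (Real.Gamma_pos_of_pos (by positivity)).ne'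
  have h2 : Real.Gamma (((k : ℝ) + 1) / 2) ≠ 0 := (Real.Gamma_pos_of_pos (by positivity)).ne'
  unfold meanAbs gam
  rw [div_pow, mul_pow, Real.sq_sqrt Real.pi_pos.le]
  field_simp

theorem integral_sphere_abs_inner (hk : 1 ≤ k) (u : EuclideanSpace ℝ (Fin k)) (hu : ‖u‖ = 1) :
    ∫ g : unitSphere k, |inner ℝ u g.1| ∂(uniformSphere k) = meanAbs k := by
  rw [integral_uniformSphere hk 1 (fun x ↦ |inner ℝ u x|)
    (fun r hr x ↦ by rw [inner_smul_right, abs_mul, abs_of_pos hr, pow_one]),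
    integral_ridge_mul_exp_neg_norm_sq hk (fun t ↦ |t|) u hu, integral_abs_mul_exp_neg_sq]
  obtain ⟨j, rfl⟩ : ∃ j, k = j + 1 := ⟨k - 1, by omega⟩
  have : √Real.pi ≠ 0 := by positivity
  simp only [meanAbs, Nat.add_sub_cancel, pow_succ, Nat.cast_one]
  field_simp

theorem integral_sphere_inner_sq (hk : 1 ≤ k) (u : EuclideanSpace ℝ (Fin k)) (hu : ‖u‖ = 1) :
    ∫ g : unitSphere k, inner ℝ u g.1 ^ 2 ∂(uniformSphere k) = 1 / k := by
  have hk0 : (0 : ℝ) < k := by exact_mod_cast hk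
  have hG : Real.Gamma ((k : ℝ) / 2) ≠ 0 := (Real.Gamma_pos_of_pos (by positivity)).ne'
  rw [integral_uniformSphere hk 2 (fun x ↦ inner ℝ u x ^ 2)
    (fun r hr x ↦ by rw [inner_smul_right, mul_pow]),
    integral_ridge_mul_exp_neg_norm_sq hk (fun t ↦ t ^ 2) u hu, integral_sq_mul_exp_neg_sq]
  have hG2 : Real.Gamma (((k : ℝ) + (2 : ℕ)) / 2) = k / 2 * Real.Gamma ((k : ℝ) / 2) := by
    rw [← Real.Gamma_add_one (by positivity)]
    congr 1
    push_cast
    ring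
  rw [hG2, ← pow_sub_one_mul (Nat.one_le_iff_ne_zero.1 hk) √Real.pi]
  have : √Real.pi ≠ 0 := by positivity
  field_simp

theorem abs_inner_le_of_mem_unitSphere (v : EuclideanSpace ℝ (Fin k)) (g : unitSphere k) :
    |inner ℝ v g.1| ≤ ‖v‖ := by
  have h := abs_real_inner_le_norm v g.1
  rwa [norm_eq_of_mem_sphere, mul_one] at h

theorem measurable_inner_unitSphere (v : EuclideanSpace ℝ (Fin k)) :
    Measurable fun g : unitSphere k ↦ inner ℝ v g.1 :=
  (continuous_const.inner continuous_subtype_val).measurable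

theorem integrable_uniformSphere (hk : 1 ≤ k) {f : unitSphere k → ℝ} (hf : Measurable f) (C : ℝ)
    (hC : ∀ g, |f g| ≤ C) : Integrable f (uniformSphere k) :=
  have := isProbabilityMeasure_uniformSphere hk
  Integrable.of_bound hf.aestronglyMeasurable C (.of_forall hC)

/-- Conditioning on `⟪u, g⟫`, only the component of `v` along `u` contributes. -/
theorem integral_sphere_ridge_mul_inner (hk : 1 ≤ k) (d : ℕ) {φ : ℝ → ℝ}
    (hφm : Measurable φ) (hφ : ∀ r : ℝ, 0 < r → ∀ t, φ (r * t) = r ^ d * φ t)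
    (hφ1 : ∀ t, |t| ≤ 1 → |φ t| ≤ 1)
    (u v : EuclideanSpace ℝ (Fin k)) (hu : ‖u‖ = 1) :
    ∫ g : unitSphere k, φ (inner ℝ u g.1) * inner ℝ v g.1 ∂(uniformSphere k) =
      inner ℝ u v *
        ∫ g : unitSphere k, φ (inner ℝ u g.1) * inner ℝ u g.1 ∂(uniformSphere k) := by
  have hint : ∀ w : EuclideanSpace ℝ (Fin k), Integrable
      (fun g : unitSphere k ↦ φ (inner ℝ u g.1) * inner ℝ w g.1) (uniformSphere k) := fun w ↦ by
    refine integrable_uniformSphere hk ((hφm.comp (measurable_inner_unitSphere u)).mul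
      (measurable_inner_unitSphere w)) ‖w‖ fun g ↦ ?_
    rw [abs_mul, ← one_mul ‖w‖]
    exact mul_le_mul (hφ1 _ (hu ▸ abs_inner_le_of_mem_unitSphere u g))
      (abs_inner_le_of_mem_unitSphere w g) (abs_nonneg _) zero_le_one
  -- The part of `v` orthogonal to `u`, which contributes zero by reflection.
  set w := v - (inner ℝ u v : ℝ) • u with hw
  have huw : inner ℝ u w = 0 := by
    rw [hw, inner_sub_right, inner_smul_right, real_inner_self_eq_norm_sq, hu]
    ring
  have h0 : ∫ g : unitSphere k, φ (inner ℝ u g.1) * inner ℝ w g.1 ∂(uniformSphere k) = 0 := by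
    rw [integral_uniformSphere hk (d + 1) (fun x ↦ φ (inner ℝ u x) * inner ℝ w x)
      (fun r hr x ↦ by rw [inner_smul_right, inner_smul_right, hφ r hr]; ring),
      integral_ridge_mul_inner_eq_zero φ u w huw, zero_div, zero_mul]
  rw [← integral_const_mul, ← sub_eq_zero, ← integral_sub (hint v) ((hint u).const_mul _), ← h0]
  refine integral_congr_ae (.of_forall fun g ↦ ?_)
  simp only [hw, inner_sub_left, real_inner_smul_left]
  ring

theorem integral_sphere_sgn_mul_inner (hk : 1 ≤ k) (u v : EuclideanSpace ℝ (Fin k))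
    (hu : ‖u‖ = 1) :
    ∫ g : unitSphere k, sgn (inner ℝ u g.1) * inner ℝ v g.1 ∂(uniformSphere k) =
      inner ℝ u v * meanAbs k := by
  rw [integral_sphere_ridge_mul_inner hk 0 measurable_sgn
    (fun r hr t ↦ by rw [sgn_pos_mul hr, pow_zero, one_mul]) (fun t _ ↦ (abs_sgn t).le) u v hu]
  simp_rw [sgn_mul_self]
  rw [integral_sphere_abs_inner hk u hu]

theorem integral_sphere_inner_mul_inner (hk : 1 ≤ k) (u v : EuclideanSpace ℝ (Fin k))
    (hu : ‖u‖ = 1) :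
    ∫ g : unitSphere k, inner ℝ u g.1 * inner ℝ v g.1 ∂(uniformSphere k) =
      inner ℝ u v * (1 / k) := by
  have h := integral_sphere_ridge_mul_inner hk 1 (φ := fun t ↦ t) measurable_id
    (fun r hr t ↦ by rw [pow_one]) (fun t ht ↦ ht) u v hu
  rw [h, ← integral_sphere_inner_sq hk u hu]
  simp_rw [sq]

theorem iqp_eq_sum {n : ℕ} (A : Matrix (Fin n) (Fin n) ℝ) (x : Fin n → ℝ) :
    iqp A x = ∑ i, ∑ j, A i j * (x i * x j) := by
  simp only [iqp, dotProduct, mulVec, Finset.mul_sum]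
  exact Finset.sum_congr rfl fun i _ ↦ Finset.sum_congr rfl fun j _ ↦ by ring

theorem integral_iqp {Ω : Type*} [MeasurableSpace Ω] {μ : Measure Ω} {n : ℕ}
    (A : Matrix (Fin n) (Fin n) ℝ) {y : Fin n → Ω → ℝ}
    (hy : ∀ i j, Integrable (fun ω ↦ y i ω * y j ω) μ) :
    ∫ ω, iqp A (fun i ↦ y i ω) ∂μ = ∑ i, ∑ j, A i j * ∫ ω, y i ω * y j ω ∂μ := by
  simp_rw [iqp_eq_sum]
  rw [integral_finsetSum _ fun i _ ↦ integrable_finsetSum _ fun j _ ↦ (hy i j).const_mul (A i j)]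
  refine Finset.sum_congr rfl fun i _ ↦ ?_
  rw [integral_finsetSum _ fun j _ ↦ (hy i j).const_mul (A i j)]
  simp_rw [integral_const_mul]

theorem sdp_gram_eq_sum {n : ℕ} (A : Matrix (Fin n) (Fin n) ℝ) (X : Matrix (Fin n) (Fin k) ℝ) :
    sdp A (X * Xᵀ) =
      ∑ i, ∑ j, A i j * inner ℝ (WithLp.toLp 2 (X i)) (WithLp.toLp 2 (X j)) := by
  simp only [sdp, trace, diag_apply, mul_apply, transpose_apply, PiLp.inner_apply,
    RCLike.inner_apply, conj_trivial]

theorem roundedPoint_apply {n : ℕ} (X : Matrix (Fin n) (Fin k) ℝ) (g : unitSphere k) (i : Fin n) :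
    roundedPoint X g i = sgn (inner ℝ (WithLp.toLp 2 (X i)) g.1) := by
  simp only [roundedPoint, mulVec, dotProduct, PiLp.inner_apply, RCLike.inner_apply,
    conj_trivial, mul_comm]

theorem measurable_roundedPoint {n : ℕ} (X : Matrix (Fin n) (Fin k) ℝ) (i : Fin n) :
    Measurable fun g ↦ roundedPoint X g i := by
  simp_rw [roundedPoint_apply]
  exact measurable_sgn.comp (measurable_inner_unitSphere _)

theorem integrable_roundedPoint_mul (hk : 1 ≤ k) {n : ℕ} (X : Matrix (Fin n) (Fin k) ℝ)
    (i j : Fin n) :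
    Integrable (fun g ↦ roundedPoint X g i * roundedPoint X g j) (uniformSphere k) :=
  integrable_uniformSphere hk ((measurable_roundedPoint X i).mul (measurable_roundedPoint X j)) 1
    fun g ↦ by rw [abs_mul, roundedPoint, roundedPoint, abs_sgn, abs_sgn, one_mul]

theorem integrable_iqp_roundedPoint (hk : 1 ≤ k) {n : ℕ} (A : Matrix (Fin n) (Fin n) ℝ)
    (X : Matrix (Fin n) (Fin k) ℝ) :
    Integrable (fun g ↦ iqp A (roundedPoint X g)) (uniformSphere k) := by
  simp_rw [iqp_eq_sum]
  exact integrable_finsetSum _ fun i _ ↦ integrable_finsetSum _ fun j _ ↦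
    (integrable_roundedPoint_mul hk X i j).const_mul _

/-- Subtracting from `sgn (X g)` its projection onto the linear functions of `g` leaves a
nonnegative quadratic form. -/
theorem le_expectedRounded (hk : 1 ≤ k) {n : ℕ} {A : Matrix (Fin n) (Fin n) ℝ}
    (hA : A.PosSemidef) (X : Matrix (Fin n) (Fin k) ℝ)
    (hX : ∀ i, WithLp.toLp 2 (X i) ∈ unitSphere k) :
    2 / (Real.pi * gam k) * sdp A (X * Xᵀ) ≤ expectedRounded A X := by
  have hk0 : (0 : ℝ) < k := by exact_mod_cast hk
  let x : Fin n → EuclideanSpace ℝ (Fin k) := fun i ↦ WithLp.toLp 2 (X i)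
  have hx : ∀ i, ‖x i‖ = 1 := fun i ↦ mem_sphere_zero_iff_norm.1 (hX i)
  set m := meanAbs k
  let p : Fin n → unitSphere k → ℝ := fun i g ↦ inner ℝ (x i) g.1
  let s : Fin n → unitSphere k → ℝ := fun i g ↦ roundedPoint X g i
  have hs : ∀ i g, s i g = sgn (p i g) := fun i g ↦ roundedPoint_apply X g i
  have hpm : ∀ i, Measurable (p i) := fun i ↦ measurable_inner_unitSphere _
  have hsm : ∀ i, Measurable (s i) := fun i ↦ measurable_roundedPoint X i
  have hp1 : ∀ i g, |p i g| ≤ 1 := fun i g ↦ hx i ▸ abs_inner_le_of_mem_unitSphere (x i) g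
  have hs1 : ∀ i g, |s i g| ≤ 1 := fun i g ↦ by rw [hs, abs_sgn]
  have hmul : ∀ a b : ℝ, |a| ≤ 1 → |b| ≤ 1 → |a * b| ≤ 1 := fun a b ha hb ↦ by
    rw [abs_mul]; exact mul_le_one₀ ha (abs_nonneg _) hb
  have iss : ∀ i j, Integrable (fun g ↦ s i g * s j g) (uniformSphere k) :=
    integrable_roundedPoint_mul hk X
  have isp : ∀ i j, Integrable (fun g ↦ s i g * p j g) (uniformSphere k) := fun i j ↦
    integrable_uniformSphere hk ((hsm i).mul (hpm j)) 1 fun g ↦ hmul _ _ (hs1 i g) (hp1 j g)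
  have ipp : ∀ i j, Integrable (fun g ↦ p i g * p j g) (uniformSphere k) := fun i j ↦
    integrable_uniformSphere hk ((hpm i).mul (hpm j)) 1 fun g ↦ hmul _ _ (hp1 i g) (hp1 j g)
  have esp : ∀ i j, ∫ g, s i g * p j g ∂(uniformSphere k) = inner ℝ (x i) (x j) * m :=
    fun i j ↦ by
      simp_rw [hs]
      exact integral_sphere_sgn_mul_inner hk (x i) (x j) (hx i)
  have epp : ∀ i j, ∫ g, p i g * p j g ∂(uniformSphere k) = inner ℝ (x i) (x j) * (1 / k) :=
    fun i j ↦ integral_sphere_inner_mul_inner hk (x i) (x j) (hx i)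
  -- The coefficient `k * m` is `𝔼[s i * p i] / 𝔼[p i ^ 2]`. The correction terms add up to `-2km² +
  -- (km)²/k = -km²` times the inner product.
  have hres : ∀ i j, Integrable (fun g ↦ (s i g - k * m * p i g) * (s j g - k * m * p j g))
        (uniformSphere k) ∧
      ∫ g, (s i g - k * m * p i g) * (s j g - k * m * p j g) ∂(uniformSphere k) =
        ∫ g, s i g * s j g ∂(uniformSphere k) - k * m ^ 2 * inner ℝ (x i) (x j) := by
    intro i j
    have e : (fun g ↦ (s i g - k * m * p i g) * (s j g - k * m * p j g)) =
        fun g ↦ (s i g * s j g - k * m * (s i g * p j g)) -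
          (k * m * (s j g * p i g) - (k * m) ^ 2 * (p i g * p j g)) := by
      funext g; ring
    have I1 : Integrable (fun g ↦ s i g * s j g - k * m * (s i g * p j g)) (uniformSphere k) :=
      (iss i j).sub ((isp i j).const_mul (k * m))
    have I2 : Integrable (fun g ↦ k * m * (s j g * p i g) - (k * m) ^ 2 * (p i g * p j g))
        (uniformSphere k) := ((isp j i).const_mul (k * m)).sub ((ipp i j).const_mul ((k * m) ^ 2))
    rw [e]
    refine ⟨I1.sub I2, ?_⟩
    rw [integral_sub I1 I2, integral_sub (iss i j) ((isp i j).const_mul _),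
      integral_sub ((isp j i).const_mul _) ((ipp i j).const_mul _)]
    simp only [integral_const_mul, esp, epp, real_inner_comm (x i) (x j)]
    field_simp
    ring
  have hnn : 0 ≤ ∫ g, iqp A (fun i ↦ s i g - k * m * p i g) ∂(uniformSphere k) :=
    integral_nonneg fun g ↦ hA.dotProduct_mulVec_nonneg _
  have hE : expectedRounded A X = ∑ i, ∑ j, A i j * ∫ g, s i g * s j g ∂(uniformSphere k) :=
    integral_iqp A iss
  rw [integral_iqp A fun i j ↦ (hres i j).1] at hnn
  simp_rw [fun i j ↦ (hres i j).2, mul_sub, Finset.sum_sub_distrib, ← hE] at hnn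
  rw [← mul_meanAbs_sq hk, sdp_gram_eq_sum, Finset.mul_sum]
  simp_rw [Finset.mul_sum]
  refine (sub_nonneg.1 hnn).trans' (le_of_eq ?_)
  exact Finset.sum_congr rfl fun i _ ↦ Finset.sum_congr rfl fun j _ ↦ by ring

/-- By cyclicity this is the trace of `Xᵀ A X`. It makes a nonzero denominator of `ratio` positive.
-/
theorem sdp_gram_nonneg {n : ℕ} {A : Matrix (Fin n) (Fin n) ℝ} (hA : A.PosSemidef)
    (X : Matrix (Fin n) (Fin k) ℝ) : 0 ≤ sdp A (X * Xᵀ) := by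
  have h := (hA.conjTranspose_mul_mul_same X).trace_nonneg
  rwa [conjTranspose_eq_transpose_of_trivial, Matrix.mul_assoc, trace_mul_comm, Matrix.mul_assoc] at h

end Grothendieck

theorem mainTheorem2 :
    (∀ (n k : ℕ) (_hk : 1 ≤ k)
        (A : Matrix (Fin n) (Fin n) ℝ) (_hA : A.PosSemidef)
        (X : Matrix (Fin n) (Fin k) ℝ)
        (_hX : ∀ i, WithLp.toLp 2 (X i) ∈ Grothendieck.unitSphere k),
      Integrable (fun g => Grothendieck.iqp A (Grothendieck.roundedPoint X g))
          (Grothendieck.uniformSphere k) ∧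
      2 / (Real.pi * Grothendieck.gam k) * Grothendieck.sdp A (X * Xᵀ)
          ≤ Grothendieck.expectedRounded A X ∧
      (Grothendieck.sdp A (X * Xᵀ) ≠ 0 →
        2 / (Real.pi * Grothendieck.gam k) ≤ Grothendieck.ratio A X)) ∧
    (∃ c C : ℝ, 0 < c ∧ 0 < C ∧ ∀ k : ℕ, 1 ≤ k →
      c / (k : ℝ) ≤ 1 - Grothendieck.gam k ∧ 1 - Grothendieck.gam k ≤ C / (k : ℝ)) ∧
    (∃ ε : ℕ → ℝ, ε =o[atTop] (fun k : ℕ => 1 / (k : ℝ)) ∧ ∀ k : ℕ, 1 ≤ k →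
      2 / (Real.pi * Grothendieck.gam k)
        = 2 / Real.pi * (1 + 1 / (2 * (k : ℝ)) + ε k)) := by
  refine ⟨fun n k hk A hA X hX ↦ ?_, ⟨1 / 3, 1, by norm_num, one_pos,
    fun k hk ↦ Grothendieck.one_sub_gam_bounds hk⟩, Grothendieck.two_div_pi_mul_gam_asymptotic⟩
  have h := Grothendieck.le_expectedRounded hk hA X hX
  refine ⟨Grothendieck.integrable_iqp_roundedPoint hk A X, h, fun h0 ↦ ?_⟩
  exact (le_div_iff₀ ((Grothendieck.sdp_gram_nonneg hA X).lt_of_ne' h0)).2 h
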